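/- Let $2\le n\le N$ be integers and let $Z=(z_{j,r})\in\mathbb{C}^{N\times n}$ satisfy $|z_{j,r}|\le 1$ for all $1\le j\le N$, $1\le r\le n$. Let $$\operatorname{Per}(Z)=\sum_{(j_1,\dots,j_n)}\prod_{r=1}^n z_{j_r,r},$$ where the sum runs over all $n$-tuples of pairwise distinct elements of $\{1,\dots,N\}$. Put $\widetilde z_r=\frac1N\sum_{j=1}^N z_{j,r}$ and $$\alpha=\frac1{nN}\sum_{r=1}^n\sum_{j=1}^N|z_{j,r}-\widetilde z_r|^2,\qquad \beta=\frac1n\sum_{r=1}^n|\widetilde z_r|^2,$$ $$\vartheta=\frac{1}{N(N-1)\sqrt{n(n-1)}}\Big(\sum_{\substack{1\le r,s\le n\\ r\ne s}}\Big(\sum_{\substack{1\le u,v\le N\\ u\ne v}}|z_{u,r}-z_{v,r}|\,|z_{u,s}-z_{v,s}|\Big)^2\Big)^{1/2}.$$ Then $$\Big|\frac{(N-n)!}{N!}\operatorname{Per}(Z)-\prod_{r=1}^n\widetilde z_r\Big|\;\le\;\frac{n-1}{2N}\,\vartheta\,\frac{1-\beta^{n/4}}{1-\sqrt\beta}\;\le\;\frac{n-1}{N-1}\,\alpha\,\min\Big\{\frac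 n2,\frac1{1-\sqrt\beta}\Big\}\;\le\;(1+\sqrt\beta)\,\frac{n-1}{N-1}.$$ Here, if $\beta=1$, the quotient $\frac{1-\beta^{n/4}}{1-\sqrt\beta}$ is read as its limit $\frac n2$ and $\frac1{1-\sqrt\beta}$ as $\infty$. -/

import Mathlib

open scoped BigOperators

noncomputable section

namespace RectPerm

variable {N n : ℕ}

/-- The permanent of an `N × n` complex matrix: the sum, over all injective maps `j` from the
column indices to the row indices, of the products `∏ r, Z (j r) r`. -/
def per (Z : Matrix (Fin N) (Fin n) ℂ) : ℂ :=
  ∑ j : Fin n ↪ Fin N, ∏ r : Fin n, Z (j r) r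

/-- The arithmetic mean of the entries of column `r`. -/
def colMean (Z : Matrix (Fin N) (Fin n) ℂ) (r : Fin n) : ℂ :=
  (1 / (N : ℂ)) * ∑ j : Fin N, Z j r

/-- `α`: the mean squared deviation of the entries from their column means. -/
def alpha (Z : Matrix (Fin N) (Fin n) ℂ) : ℝ :=
  (1 / ((n : ℝ) * (N : ℝ))) * ∑ r : Fin n, ∑ j : Fin N, ‖Z j r - colMean Z r‖ ^ 2

/-- `β`: the mean of the squared absolute values of the column means. -/
def beta (Z : Matrix (Fin N) (Fin n) ℂ) : ℝ :=
  (1 / (n : ℝ)) * ∑ r : Fin n, ‖colMean Z r‖ ^ 2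

/-- `ϑ`: both sums run over ordered pairs of distinct indices, the outer one over pairs of
columns, the inner one over pairs of rows. -/
def theta (Z : Matrix (Fin N) (Fin n) ℂ) : ℝ :=
  (1 / ((N : ℝ) * ((N : ℝ) - 1) * √((n : ℝ) * ((n : ℝ) - 1)))) *
    √(∑ p : Fin n × Fin n with p.1 ≠ p.2,
        (∑ q : Fin N × Fin N with q.1 ≠ q.2,
          ‖Z q.1 p.1 - Z q.2 p.1‖ * ‖Z q.1 p.2 - Z q.2 p.2‖) ^ 2)

/-- `(1 - β ^ (n / 4)) / (1 - √β)`, with the indeterminate value at `β = 1` read as its limit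
`n / 2`. -/
def geomQuot (n : ℕ) (β : ℝ) : ℝ :=
  if β = 1 then (n : ℝ) / 2 else (1 - β ^ ((n : ℝ) / 4)) / (1 - √β)

/-- `min {n / 2, 1 / (1 - √β)}`, with `1 / 0 = ∞`, so that the value at `β = 1` is `n / 2`. -/
def minFactor (n : ℕ) (β : ℝ) : ℝ :=
  if β = 1 then (n : ℝ) / 2 else min ((n : ℝ) / 2) (1 / (1 - √β))

end RectPerm

end

/-!
Let `σ` be a uniformly random permutation of the rows. The normalised permanent is the mean of
`∏ r, Z (σ r) r`. If column `s` were evaluated at an independent uniform row instead of at `σ s`,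
the mean would factor; this row differs from all rows used by the other columns, and then has the
same effect as `σ s`, unless it is the row `σ r` of some column `r`. In that case, exchanging
`σ r` and `σ s` symmetrises the error into a product of differences
`(Z (σ r) r - Z (σ s) r) * (Z (σ r) s - Z (σ s) s)`. Splitting off one column after another
telescopes these errors. The permanent does not depend on the order of the columns, so the resulting
bound may be averaged over all orders; Cauchy–Schwarz then separates the differences, which give
`ϑ`, from a product of distinct column means, whose mean square Maclaurin's inequality bounds by a
power of `β`. Maclaurin's inequality is itself a case of the same recursion, since for equal real
columns the products of differences are squares.

The comparison of `ϑ` with `α` is Cauchy–Schwarz over pairs of rows together with the fact that the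
mean of `|z_u - z_v| ^ 2` over all pairs is twice the variance; and `α + β ≤ 1` because variance
plus squared mean is the mean square.
-/

namespace RectPerm

open Finset Equiv

variable {ι κ : Type*} [Fintype ι]

theorem cast_card_offDiag_univ (K : Type*) [CommRing K] :
    (#(univ : Finset ι).offDiag : K) = Fintype.card ι * (Fintype.card ι - 1) := by
  rw [offDiag_card, card_univ, Nat.cast_sub (Nat.le_mul_self _), Nat.cast_mul, mul_sub_one]

section PermMean

variable {M R : Type*} [AddCommMonoid M] [Module ℚ≥0 M] [CommRing R] [Module ℚ≥0 R]

theorem expect_mul_right {G : Type*} [Group G] [Fintype G] (τ : G) (g : G → M) :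
    𝔼 σ, g (σ * τ) = 𝔼 σ, g σ :=
  Fintype.expect_equiv (Equiv.mulRight τ) _ _ fun _ => rfl

theorem expect_smul_eq_expect {G X : Type*} [Group G] [Fintype G] [Fintype X] [MulAction G X]
    [MulAction.IsPretransitive G X] (a : X) (g : X → M) : 𝔼 σ : G, g (σ • a) = 𝔼 b, g b := by
  have orbit_mean_eq (b : X) : 𝔼 σ : G, g (σ • b) = 𝔼 σ : G, g (σ • a) := by
    obtain ⟨τ, rfl⟩ := MulAction.exists_smul_eq G a b
    simpa only [mul_smul] using expect_mul_right τ fun σ : G => g (σ • a)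
  have : Nonempty X := ⟨a⟩
  calc 𝔼 σ : G, g (σ • a)
      = 𝔼 b, 𝔼 σ : G, g (σ • b) := by simp only [orbit_mean_eq, Fintype.expect_const]
    _ = 𝔼 σ : G, 𝔼 b, g (σ • b) := expect_comm _ _ _
    _ = 𝔼 _σ : G, 𝔼 b, g b :=
        expect_congr rfl fun σ _ => Fintype.expect_equiv (MulAction.toPerm σ) _ _ fun _ => rfl
    _ = 𝔼 b, g b := Fintype.expect_const _

variable [DecidableEq ι]

theorem expect_perm_smul_embedding [Fintype κ] (f : κ ↪ ι) (g : (κ ↪ ι) → M) :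
    𝔼 σ : Perm ι, g (σ • f) = 𝔼 j, g j :=
  have : MulAction.IsPretransitive (Perm ι) (κ ↪ ι) := ⟨Perm.exists_smul_eq_embedding⟩
  expect_smul_eq_expect f g

theorem expect_perm_pair {a b : ι} (hab : a ≠ b) (g : ι → ι → M) :
    𝔼 σ : Perm ι, g (σ a) (σ b) = 𝔼 q ∈ univ.offDiag, g q.1 q.2 := by
  refine (expect_perm_smul_embedding (Function.Embedding.embFinTwo hab)
    fun j => g (j 0) (j 1)).trans ?_
  refine expect_bij (fun j _ => (j 0, j 1)) (by simp) (fun _ _ => rfl) ?_ ?_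
  · simp only [Prod.mk.injEq]
    exact fun j _ k _ h => Function.Embedding.ext (Fin.forall_fin_two.2 h)
  · rintro ⟨u, v⟩ huv
    have huv : u ≠ v := by simpa using huv
    exact ⟨Function.Embedding.embFinTwo huv, mem_univ _, rfl⟩

theorem expect_perm_swap_mul_prod (f : κ ↪ ι) (x : κ → ι → R) (g : ι → ι → R) {a b : ι}
    {A : Finset κ} (ha : ∀ q ∈ A, f q ≠ a) (hb : ∀ q ∈ A, f q ≠ b) :
    𝔼 σ : Perm ι, g (σ b) (σ a) * ∏ q ∈ A, x q (σ (f q))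
      = 𝔼 σ : Perm ι, g (σ a) (σ b) * ∏ q ∈ A, x q (σ (f q)) := by
  rw [← expect_mul_right (swap a b)]
  refine expect_congr rfl fun σ _ => ?_
  have swap_fixes : ∏ q ∈ A, x q ((σ * swap a b) (f q)) = ∏ q ∈ A, x q (σ (f q)) :=
    prod_congr rfl fun q hq => by
      rw [Perm.mul_apply, swap_apply_of_ne_of_ne (ha q hq) (hb q hq)]
  rw [swap_fixes, Perm.mul_apply, Perm.mul_apply, swap_apply_left, swap_apply_right]

theorem two_nsmul_expect_perm_mul_sub (f : κ ↪ ι) (x : κ → ι → R) {B : Finset κ} {r s : κ}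
    (hr : r ∉ B) (hs : s ∉ B) :
    2 • 𝔼 σ : Perm ι, x r (σ (f r)) * (x s (σ (f r)) - x s (σ (f s)))
          * ∏ q ∈ B, x q (σ (f q))
      = 𝔼 σ : Perm ι, (x r (σ (f r)) - x r (σ (f s))) * (x s (σ (f r)) - x s (σ (f s)))
          * ∏ q ∈ B, x q (σ (f q)) := by
  have swapped := expect_perm_swap_mul_prod f x (fun u v => x r u * (x s u - x s v))
    (fun q hq => f.injective.ne (ne_of_mem_of_not_mem hq hr))
    (fun q hq => f.injective.ne (ne_of_mem_of_not_mem hq hs))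
  rw [two_nsmul]
  nth_rewrite 2 [← swapped]
  rw [← expect_add_distrib]
  exact expect_congr rfl fun σ _ => by ring

variable [DecidableEq κ]

theorem card_nsmul_expect_mul_sub_expect_perm_prod_insert (f : κ ↪ ι) (x : κ → ι → R)
    {A : Finset κ} {s : κ} (hs : s ∉ A) :
    Fintype.card ι • ((𝔼 i, x s i) * 𝔼 σ : Perm ι, ∏ r ∈ A, x r (σ (f r))
        - 𝔼 σ : Perm ι, ∏ r ∈ insert s A, x r (σ (f r)))
      = ∑ r ∈ A, 𝔼 σ : Perm ι, x r (σ (f r)) * (x s (σ (f r)) - x s (σ (f s)))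
          * ∏ q ∈ A.erase r, x q (σ (f q)) := by
  -- `W i` replaces the row `σ (f s)` drawn for column `s` by the row `σ i`.
  let W (i : ι) : R := 𝔼 σ : Perm ι, x s (σ i) * ∏ r ∈ A, x r (σ (f r))
  have expect_W : (𝔼 i, x s i) * 𝔼 σ : Perm ι, ∏ r ∈ A, x r (σ (f r)) = 𝔼 i, W i := by
    rw [expect_comm, mul_expect]
    refine expect_congr rfl fun σ _ => ?_
    rw [← expect_mul, Fintype.expect_equiv σ (fun i => x s (σ i)) (x s) fun _ => rfl]
  have W_self : 𝔼 σ : Perm ι, ∏ r ∈ insert s A, x r (σ (f r)) = W (f s) :=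
    expect_congr rfl fun σ _ => prod_insert hs
  have W_eq_of_notMem {i : ι} (hi : i ∉ A.map f) : W i - W (f s) = 0 := by
    refine sub_eq_zero.2 (expect_perm_swap_mul_prod f x (fun u _ => x s u) ?_ ?_)
    · exact fun q hq => f.injective.ne (ne_of_mem_of_not_mem hq hs)
    · exact fun q hq h => hi (mem_map.2 ⟨q, hq, h⟩)
  calc Fintype.card ι • _
      = ∑ i, (W i - W (f s)) := by
        rw [expect_W, W_self, smul_sub, Fintype.card_smul_expect, sum_sub_distrib, sum_const,
          card_univ]
    _ = ∑ r ∈ A, (W (f r) - W (f s)) := by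
        rw [← sum_map A f fun i => W i - W (f s)]
        exact (sum_subset (subset_univ _) fun i _ hi => W_eq_of_notMem hi).symm
    _ = _ := by
        refine sum_congr rfl fun r hr => ?_
        rw [← expect_sub_distrib]
        refine expect_congr rfl fun σ _ => ?_
        rw [← mul_prod_erase A (fun q => x q (σ (f q))) hr]
        ring

theorem two_mul_card_nsmul_expect_mul_sub_expect_perm_prod_insert (f : κ ↪ ι) (x : κ → ι → R)
    {A : Finset κ} {s : κ} (hs : s ∉ A) :
    (2 * Fintype.card ι) • ((𝔼 i, x s i) * 𝔼 σ : Perm ι, ∏ r ∈ A, x r (σ (f r))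
        - 𝔼 σ : Perm ι, ∏ r ∈ insert s A, x r (σ (f r)))
      = ∑ r ∈ A, 𝔼 σ : Perm ι,
          (x r (σ (f r)) - x r (σ (f s))) * (x s (σ (f r)) - x s (σ (f s)))
            * ∏ q ∈ A.erase r, x q (σ (f q)) := by
  rw [mul_nsmul', card_nsmul_expect_mul_sub_expect_perm_prod_insert f x hs, ← sum_nsmul]
  exact sum_congr rfl fun r _ =>
    two_nsmul_expect_perm_mul_sub f x (notMem_erase r A) fun h => hs (mem_of_mem_erase h)

end PermMean

section Real

/- The weights `(v (σ r) - v (σ s)) ^ 2` in the recursion are nonnegative, so adjoining a factor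
multiplies the mean by at most `𝔼 i, v i`. -/
theorem expect_perm_prod_le_expect_pow [DecidableEq ι] {v : ι → ℝ} (hv : ∀ i, 0 ≤ v i)
    (A : Finset ι) :
    𝔼 σ : Perm ι, ∏ r ∈ A, v (σ r) ≤ (𝔼 i, v i) ^ #A := by
  induction A using Finset.induction_on with
  | empty => simp
  | insert s A hs ih =>
    have : Nonempty ι := ⟨s⟩
    have recursion := two_mul_card_nsmul_expect_mul_sub_expect_perm_prod_insert
      (Function.Embedding.refl ι) (fun _ => v) hs
    simp only [Function.Embedding.refl_apply, nsmul_eq_mul] at recursion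
    have rhs_nonneg : 0 ≤ ∑ r ∈ A, 𝔼 σ : Perm ι,
        (v (σ r) - v (σ s)) * (v (σ r) - v (σ s)) * ∏ q ∈ A.erase r, v (σ q) :=
      sum_nonneg fun r _ => expect_nonneg fun σ _ =>
        mul_nonneg (mul_self_nonneg _) (prod_nonneg fun q _ => hv _)
    rw [← recursion] at rhs_nonneg
    calc 𝔼 σ : Perm ι, ∏ r ∈ insert s A, v (σ r)
        ≤ (𝔼 i, v i) * 𝔼 σ : Perm ι, ∏ r ∈ A, v (σ r) :=
          sub_nonneg.1 (nonneg_of_mul_nonneg_right rhs_nonneg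
            (by exact_mod_cast mul_pos two_pos Fintype.card_pos))
      _ ≤ (𝔼 i, v i) * (𝔼 i, v i) ^ #A :=
          mul_le_mul_of_nonneg_left ih (expect_nonneg fun i _ => hv i)
      _ = (𝔼 i, v i) ^ #(insert s A) := by rw [card_insert_of_notMem hs, pow_succ']

theorem expect_offDiag_mul_le_expect_sq {v : ι → ℝ} (hv : ∀ i, 0 ≤ v i) :
    𝔼 p ∈ univ.offDiag, v p.1 * v p.2 ≤ (𝔼 i, v i) ^ 2 := by
  classical
  rcases subsingleton_or_nontrivial ι with _ | _
  · have : (univ : Finset ι).offDiag = ∅ :=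
      eq_empty_of_forall_notMem fun p => by simp [Subsingleton.elim p.1 p.2]
    rw [this, expect_empty]
    positivity
  · obtain ⟨a, b, hab⟩ := exists_pair_ne ι
    have := expect_perm_prod_le_expect_pow hv {a, b}
    simpa only [prod_pair hab, card_pair hab, expect_perm_pair hab fun u w => v u * v w] using this

theorem expect_perm_mul_prod_le [DecidableEq ι] {a b : ι} (hab : a ≠ b) (d : ι → ι → ℝ)
    (v : ι → ℝ) (B : Finset ι) :
    𝔼 τ : Perm ι, d (τ a) (τ b) * ∏ q ∈ B, v (τ q)
      ≤ √(𝔼 p ∈ univ.offDiag, d p.1 p.2 ^ 2) * √(𝔼 i, v i ^ 2) ^ #B := by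
  have maclaurin : 𝔼 τ : Perm ι, (∏ q ∈ B, v (τ q)) ^ 2 ≤ (𝔼 i, v i ^ 2) ^ #B := by
    simp only [← prod_pow]
    exact expect_perm_prod_le_expect_pow (fun i => sq_nonneg (v i)) B
  have hd : 0 ≤ 𝔼 p ∈ univ.offDiag, d p.1 p.2 ^ 2 := expect_nonneg fun _ _ => sq_nonneg _
  have hv : 0 ≤ 𝔼 i, v i ^ 2 := expect_nonneg fun _ _ => sq_nonneg _
  refine le_of_sq_le_sq ?_ (by positivity)
  calc (𝔼 τ : Perm ι, d (τ a) (τ b) * ∏ q ∈ B, v (τ q)) ^ 2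
      ≤ (𝔼 τ : Perm ι, d (τ a) (τ b) ^ 2) * 𝔼 τ : Perm ι, (∏ q ∈ B, v (τ q)) ^ 2 :=
        expect_mul_sq_le_sq_mul_sq _ _ _
    _ ≤ (𝔼 p ∈ univ.offDiag, d p.1 p.2 ^ 2) * (𝔼 i, v i ^ 2) ^ #B := by
        rw [expect_perm_pair hab fun u w => d u w ^ 2]
        exact mul_le_mul_of_nonneg_left maclaurin hd
    _ = _ := by rw [mul_pow, Real.sq_sqrt hd, pow_right_comm, Real.sq_sqrt hv]

end Real

section NormedRing

theorem norm_expect_le_expect_norm {E X : Type*} [NormedAddCommGroup E] [NormedSpace ℝ E]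
    [Module ℚ≥0 E] (s : Finset X) (f : X → E) : ‖𝔼 i ∈ s, f i‖ ≤ 𝔼 i ∈ s, ‖f i‖ :=
  le_expect_of_subadditive norm_zero norm_add_le fun n a => by
    simpa only [NNRat.cast_smul_eq_nnqsmul, RCLike.norm_nnratCast, NNRat.smul_def]
      using norm_smul (((n : ℚ≥0)⁻¹ : ℚ≥0) : ℝ) a

/-- The mean, over ordered pairs of distinct indices, of the product of the distances between the
corresponding values of `x` and of `y`. -/
noncomputable def meanDiffMul {E F : Type*} [SeminormedAddCommGroup E]
    [SeminormedAddCommGroup F] (x : ι → E) (y : ι → F) : ℝ :=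
  𝔼 q ∈ univ.offDiag, ‖x q.1 - x q.2‖ * ‖y q.1 - y q.2‖

/-- The root mean square of `meanDiffMul` over ordered pairs of distinct members of a family:
the quantity `ϑ` of the columns of a matrix. -/
noncomputable def rmsDiffMul [Fintype κ] {E : Type*}
    [SeminormedAddCommGroup E] (x : κ → ι → E) : ℝ :=
  √(𝔼 p ∈ univ.offDiag, meanDiffMul (x p.1) (x p.2) ^ 2)

variable {R : Type*} [NormedCommRing R]

theorem norm_prod_sub_prod_le_of_insert [LinearOrder κ] {P : Finset κ → R} {m : κ → R}
    {e : κ → Finset κ → ℝ} (P_empty : P ∅ = 1)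
    (norm_sub_le : ∀ s A, (∀ r ∈ A, r < s) → ‖P (insert s A) - m s * P A‖ ≤ e s A)
    (A : Finset κ) :
    ‖P A - ∏ r ∈ A, m r‖ ≤ ∑ t ∈ A, e t {r ∈ A | r < t} * ∏ q ∈ A with t < q, ‖m q‖ := by
  induction A using Finset.induction_on_max with
  | empty => simp [P_empty]
  | insert s A hlt ih =>
    have hs : s ∉ A := fun h => lt_irrefl s (hlt s h)
    have below_max : {r ∈ insert s A | r < s} = A := by
      rw [filter_insert, if_neg (lt_irrefl s), filter_true_of_mem hlt]
    have above_max : {q ∈ insert s A | s < q} = ∅ := by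
      rw [filter_insert, if_neg (lt_irrefl s), filter_false_of_mem fun q hq => (hlt q hq).not_gt]
    have below {t : κ} (ht : t ∈ A) : {r ∈ insert s A | r < t} = {r ∈ A | r < t} := by
      rw [filter_insert, if_neg (hlt t ht).not_gt]
    have prod_above {t : κ} (ht : t ∈ A) :
        ∏ q ∈ insert s A with t < q, ‖m q‖ = ‖m s‖ * ∏ q ∈ A with t < q, ‖m q‖ := by
      rw [filter_insert, if_pos (hlt t ht), prod_insert fun h => hs (mem_filter.1 h).1]
    calc ‖P (insert s A) - ∏ r ∈ insert s A, m r‖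
        = ‖(P (insert s A) - m s * P A) + m s * (P A - ∏ r ∈ A, m r)‖ := by
          rw [prod_insert hs, mul_sub, sub_add_sub_cancel]
      _ ≤ e s A + ‖m s‖ * ∑ t ∈ A, e t {r ∈ A | r < t} * ∏ q ∈ A with t < q, ‖m q‖ :=
          norm_add_le_of_le (norm_sub_le s A hlt)
            ((norm_mul_le _ _).trans (mul_le_mul_of_nonneg_left ih (norm_nonneg _)))
      _ = _ := by
          rw [sum_insert hs, below_max, above_max, prod_empty, mul_one, mul_sum]
          congr 1
          refine sum_congr rfl fun t ht => ?_
          rw [below ht, prod_above ht, mul_left_comm]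

variable [NormOneClass R] [NormedAlgebra ℝ R] [Module ℚ≥0 R]

theorem norm_expect_perm_prod_insert_sub_le [DecidableEq ι] [DecidableEq κ] (f : κ ↪ ι)
    {x : κ → ι → R} (hx : ∀ r i, ‖x r i‖ ≤ 1) {A : Finset κ} {s : κ} (hs : s ∉ A) :
    ‖𝔼 σ : Perm ι, ∏ r ∈ insert s A, x r (σ (f r))
        - (𝔼 i, x s i) * 𝔼 σ : Perm ι, ∏ r ∈ A, x r (σ (f r))‖
      ≤ ∑ r ∈ A, meanDiffMul (x r) (x s) / (2 * Fintype.card ι) := by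
  have : Nonempty ι := ⟨f s⟩
  rw [← sum_div, le_div_iff₀' (by positivity), norm_sub_rev, ← Nat.cast_two, ← Nat.cast_mul,
    ← nsmul_eq_mul, ← RCLike.norm_nsmul ℝ,
    two_mul_card_nsmul_expect_mul_sub_expect_perm_prod_insert f x hs]
  refine norm_sum_le_of_le A fun r hr => (norm_expect_le_expect_norm _ _).trans ?_
  rw [meanDiffMul, ← expect_perm_pair (f.injective.ne (ne_of_mem_of_not_mem hr hs))
    fun u v => ‖x r u - x r v‖ * ‖x s u - x s v‖]
  refine expect_le_expect fun σ _ => ?_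
  have norm_prod_le_one : ‖∏ q ∈ A.erase r, x q (σ (f q))‖ ≤ 1 :=
    (Finset.norm_prod_le _ _).trans (prod_le_one (fun _ _ => norm_nonneg _) fun q _ => hx q _)
  exact (norm_mul_le_of_le (norm_mul_le _ _) norm_prod_le_one).trans_eq (mul_one _)

variable [Fintype κ] [LinearOrder κ] [LocallyFiniteOrderBot κ] [LocallyFiniteOrderTop κ]

theorem norm_expect_embedding_prod_sub_le (f : κ ↪ ι) {x : κ → ι → R}
    (hx : ∀ r i, ‖x r i‖ ≤ 1) :
    ‖𝔼 j : κ ↪ ι, ∏ r, x r (j r) - ∏ r, 𝔼 i, x r i‖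
      ≤ ∑ t, ∑ r ∈ Iio t, meanDiffMul (x r) (x t) / (2 * Fintype.card ι)
          * ∏ q ∈ Ioi t, ‖𝔼 i, x q i‖ := by
  classical
  have telescoped := norm_prod_sub_prod_le_of_insert
    (P := fun A => 𝔼 σ : Perm ι, ∏ r ∈ A, x r (σ (f r))) (by simp)
    (fun s A hlt => norm_expect_perm_prod_insert_sub_le f hx fun h => lt_irrefl s (hlt s h)) univ
  rw [← expect_perm_smul_embedding f fun j => ∏ r, x r (j r)]
  simpa only [Function.Embedding.smul_apply, Perm.smul_def, filter_gt_eq_Iio, filter_lt_eq_Ioi,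
    sum_mul] using telescoped

/- The left-hand side does not depend on the order of the columns, so the preceding bound may be
averaged over all orders; this makes the right-hand side symmetric. -/
theorem norm_expect_embedding_prod_sub_le_rmsDiffMul (f : κ ↪ ι) {x : κ → ι → R}
    (hx : ∀ r i, ‖x r i‖ ≤ 1) :
    ‖𝔼 j : κ ↪ ι, ∏ r, x r (j r) - ∏ r, 𝔼 i, x r i‖
      ≤ rmsDiffMul x / (2 * Fintype.card ι)
          * ∑ t : κ, #(Iio t) * √(𝔼 r, ‖𝔼 i, x r i‖ ^ 2) ^ #(Ioi t) := by
  set c : ℝ := 2 * Fintype.card ι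
  have reordered (τ : Perm κ) := norm_expect_embedding_prod_sub_le f fun r => hx (τ r)
  have mean_reorder (τ : Perm κ) :
      𝔼 j : κ ↪ ι, ∏ r, x (τ r) (j r) = 𝔼 j : κ ↪ ι, ∏ r, x r (j r) :=
    Fintype.expect_equiv (embeddingCongr τ (Equiv.refl ι)) _ _ fun j => by
      simpa using Equiv.prod_comp τ fun r => x r (j (τ.symm r))
  have prod_reorder (τ : Perm κ) : ∏ r, 𝔼 i, x (τ r) i = ∏ r, 𝔼 i, x r i :=
    Equiv.prod_comp τ fun r => 𝔼 i, x r i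
  simp only [mean_reorder, prod_reorder] at reordered
  calc ‖𝔼 j : κ ↪ ι, ∏ r, x r (j r) - ∏ r, 𝔼 i, x r i‖
      ≤ 𝔼 τ : Perm κ, ∑ t, ∑ r ∈ Iio t, meanDiffMul (x (τ r)) (x (τ t)) / c
          * ∏ q ∈ Ioi t, ‖𝔼 i, x (τ q) i‖ := le_expect univ_nonempty fun τ _ => reordered τ
    _ = ∑ t, ∑ r ∈ Iio t, (𝔼 τ : Perm κ, meanDiffMul (x (τ r)) (x (τ t))
          * ∏ q ∈ Ioi t, ‖𝔼 i, x (τ q) i‖) / c := by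
        simp only [expect_sum_comm, expect_div, div_mul_eq_mul_div]
    _ ≤ ∑ t, ∑ _r ∈ Iio t, rmsDiffMul x * √(𝔼 r, ‖𝔼 i, x r i‖ ^ 2) ^ #(Ioi t) / c := by
        refine sum_le_sum fun t _ => sum_le_sum fun r hr => ?_
        gcongr
        exact expect_perm_mul_prod_le (mem_Iio.1 hr).ne (fun r s => meanDiffMul (x r) (x s))
          (fun q => ‖𝔼 i, x q i‖) (Ioi t)
    _ = rmsDiffMul x / c * ∑ t, #(Iio t) * √(𝔼 r, ‖𝔼 i, x r i‖ ^ 2) ^ #(Ioi t) := by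
        simp only [sum_const, nsmul_eq_mul, mul_sum]
        exact sum_congr rfl fun t _ => by ring

end NormedRing

section InnerProductSpace

variable {E : Type*} [NormedAddCommGroup E] [Module ℚ≥0 E]

/-- The mean squared deviation of a finite family of vectors from its mean: its variance under the
uniform distribution. -/
noncomputable def meanSqDev (x : ι → E) : ℝ :=
  𝔼 i, ‖x i - 𝔼 k, x k‖ ^ 2

theorem meanSqDev_nonneg (x : ι → E) : 0 ≤ meanSqDev x :=
  expect_nonneg fun _ _ => sq_nonneg _

variable [InnerProductSpace ℝ E]

theorem expect_norm_sub_sq [Nonempty ι] (x : ι → E) (y : E) :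
    𝔼 i, ‖x i - y‖ ^ 2 = meanSqDev x + ‖(𝔼 i, x i) - y‖ ^ 2 := by
  have sum_sub_mean : ∑ i, (x i - 𝔼 k, x k) = 0 := by
    rw [sum_sub_distrib, sum_const, card_univ, Fintype.card_smul_expect, sub_self]
  have expect_inner : 𝔼 i, 2 * inner ℝ (x i - 𝔼 k, x k) ((𝔼 k, x k) - y) = 0 := by
    rw [← mul_expect, Fintype.expect_eq_sum_div_card, ← sum_inner, sum_sub_mean, inner_zero_left,
      zero_div, mul_zero]
  calc 𝔼 i, ‖x i - y‖ ^ 2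
      = 𝔼 i, ‖(x i - 𝔼 k, x k) + ((𝔼 k, x k) - y)‖ ^ 2 := by simp only [sub_add_sub_cancel]
    _ = meanSqDev x + ‖(𝔼 i, x i) - y‖ ^ 2 := by
        simp only [norm_add_sq_real, expect_add_distrib, expect_inner, add_zero,
          Fintype.expect_const, meanSqDev]

theorem meanSqDev_add_norm_expect_sq [Nonempty ι] (x : ι → E) :
    meanSqDev x + ‖𝔼 i, x i‖ ^ 2 = 𝔼 i, ‖x i‖ ^ 2 := by
  simpa only [sub_zero] using (expect_norm_sub_sq x 0).symm

theorem expect_expect_norm_sub_sq [Nonempty ι] (x : ι → E) :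
    𝔼 k, 𝔼 i, ‖x i - x k‖ ^ 2 = 2 * meanSqDev x := by
  simp only [expect_norm_sub_sq, expect_add_distrib, Fintype.expect_const, two_mul]
  simp only [meanSqDev, norm_sub_rev (𝔼 i, x i)]

variable [Nontrivial ι]

theorem expect_offDiag_norm_sub_sq (x : ι → E) :
    𝔼 q ∈ univ.offDiag, ‖x q.1 - x q.2‖ ^ 2
      = 2 * Fintype.card ι / (Fintype.card ι - 1) * meanSqDev x := by
  have card_sub_one_pos : (0 : ℝ) < Fintype.card ι - 1 := by
    have : (1 : ℝ) < Fintype.card ι := by exact_mod_cast Fintype.one_lt_card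
    linarith
  have sum_offDiag : ∑ q ∈ univ.offDiag, ‖x q.1 - x q.2‖ ^ 2 = ∑ k, ∑ i, ‖x i - x k‖ ^ 2 := by
    rw [← Fintype.sum_prod_type_right']
    refine sum_subset (subset_univ _) fun q _ hq => ?_
    simp_all
  have sum_sum : ∑ k, ∑ i, ‖x i - x k‖ ^ 2
      = Fintype.card ι * Fintype.card ι * (2 * meanSqDev x) := by
    rw [← expect_expect_norm_sub_sq, mul_assoc, Fintype.card_mul_expect, mul_sum]
    simp only [Fintype.card_mul_expect]
  rw [expect_eq_sum_div_card, sum_offDiag, sum_sum, cast_card_offDiag_univ]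
  field_simp

theorem meanDiffMul_sq_le {F : Type*} [NormedAddCommGroup F] [InnerProductSpace ℝ F]
    [Module ℚ≥0 F] (x : ι → E) (y : ι → F) :
    meanDiffMul x y ^ 2 ≤ (2 * Fintype.card ι / (Fintype.card ι - 1)) ^ 2
      * (meanSqDev x * meanSqDev y) := by
  refine (expect_mul_sq_le_sq_mul_sq _ _ _).trans_eq ?_
  rw [expect_offDiag_norm_sub_sq, expect_offDiag_norm_sub_sq, mul_mul_mul_comm, sq]

theorem rmsDiffMul_le [Fintype κ] (x : κ → ι → E) :
    rmsDiffMul x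
      ≤ 2 * Fintype.card ι / (Fintype.card ι - 1) * 𝔼 r, meanSqDev (x r) := by
  have one_lt_card : (1 : ℝ) < Fintype.card ι := by exact_mod_cast Fintype.one_lt_card
  have c_nonneg : (0 : ℝ) ≤ 2 * Fintype.card ι / (Fintype.card ι - 1) :=
    div_nonneg (by positivity) (by linarith)
  refine Real.sqrt_le_iff.2
    ⟨mul_nonneg c_nonneg (expect_nonneg fun r _ => meanSqDev_nonneg _), ?_⟩
  calc 𝔼 p ∈ univ.offDiag, meanDiffMul (x p.1) (x p.2) ^ 2
      ≤ 𝔼 p ∈ univ.offDiag, (2 * Fintype.card ι / (Fintype.card ι - 1) : ℝ) ^ 2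
          * (meanSqDev (x p.1) * meanSqDev (x p.2)) :=
        expect_le_expect fun p _ => meanDiffMul_sq_le _ _
    _ ≤ (2 * Fintype.card ι / (Fintype.card ι - 1)) ^ 2 * (𝔼 r, meanSqDev (x r)) ^ 2 := by
        rw [← mul_expect]
        exact mul_le_mul_of_nonneg_left
          (expect_offDiag_mul_le_expect_sq fun r => meanSqDev_nonneg (x r)) (sq_nonneg _)
    _ = _ := (mul_pow _ _ _).symm

end InnerProductSpace

section GeometricFactor

theorem sum_range_mul_pow_mul_one_sub {R : Type*} [CommRing R] (b : R) (m : ℕ) :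
    (∑ t ∈ range (m + 1), t * b ^ (m - t)) * (1 - b) = m - ∑ i ∈ range m, b ^ (i + 1) := by
  induction m with
  | zero => simp
  | succ m ih =>
    have sum_succ : ∑ t ∈ range (m + 1 + 1), t * b ^ (m + 1 - t)
        = b * ∑ t ∈ range (m + 1), t * b ^ (m - t) + (m + 1) := by
      rw [sum_range_succ, mul_sum, Nat.sub_self, pow_zero, mul_one, Nat.cast_succ]
      congr 1
      refine sum_congr rfl fun t ht => ?_
      rw [Nat.sub_add_comm (Nat.lt_succ_iff.1 (mem_range.1 ht)), pow_succ', mul_left_comm]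
    have geom_succ : ∑ i ∈ range (m + 1), b ^ (i + 1)
        = b + b * ∑ i ∈ range m, b ^ (i + 1) := by
      simp only [sum_range_succ' _ m, mul_sum, pow_succ', pow_zero, mul_one, add_comm]
    rw [sum_succ, geom_succ, Nat.cast_succ]
    linear_combination b * ih

theorem mul_rpow_le_sum_range_pow {b : ℝ} (hb : 0 ≤ b) (m : ℕ) :
    m * b ^ ((m + 1 : ℝ) / 2) ≤ ∑ i ∈ range m, b ^ (i + 1) := by
  -- AM-GM for the factors `b ^ (i + 1)` and `b ^ (m - i)`, which are exchanged by `i ↦ m - 1 - i`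
  have amgm {i : ℕ} (hi : i < m) :
      2 * b ^ ((m + 1 : ℝ) / 2) ≤ b ^ (i + 1) + b ^ (m - 1 - i + 1) := by
    refine two_mul_le_add_of_sq_le_mul (by positivity) (by positivity) (le_of_eq ?_)
    rw [← Real.rpow_mul_natCast hb, ← pow_add, ← Real.rpow_natCast b (i + 1 + _),
      show i + 1 + (m - 1 - i + 1) = m + 1 by omega]
    push_cast
    congr 1
    ring
  have pairing := sum_le_sum fun i hi => amgm (mem_range.1 hi)
  rw [sum_add_distrib, sum_range_reflect (fun i => b ^ (i + 1)), sum_const, card_range,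
    nsmul_eq_mul] at pairing
  linarith

theorem geomQuot_of_ne_one (n : ℕ) {β : ℝ} (hβ₀ : 0 ≤ β) (hβ : β ≠ 1) :
    geomQuot n β = (1 - √β ^ ((n : ℝ) / 2)) / (1 - √β) := by
  rw [geomQuot, if_neg hβ, ← Real.rpow_div_two_eq_sqrt _ hβ₀, div_div]
  norm_num

theorem sum_mul_sqrt_pow_le_geomQuot {β : ℝ} (hβ₀ : 0 ≤ β) (hβ₁ : β ≤ 1) (m : ℕ) :
    ∑ t ∈ range (m + 1), t * √β ^ (m - t) ≤ m * geomQuot (m + 1) β := by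
  rcases eq_or_lt_of_le hβ₁ with rfl | hβ
  · have gauss : (∑ t ∈ range (m + 1), (t : ℝ)) * 2 = (m + 1) * m := by
      rw [← Nat.cast_sum]
      exact_mod_cast sum_range_id_mul_two (m + 1)
    simp only [Real.sqrt_one, one_pow, mul_one, geomQuot, if_true, Nat.cast_succ]
    linarith
  · have sqrt_lt_one : √β < 1 := by rwa [Real.sqrt_lt' one_pos, one_pow]
    rw [geomQuot_of_ne_one _ hβ₀ hβ.ne, mul_div_assoc', le_div_iff₀ (sub_pos.2 sqrt_lt_one),
      sum_range_mul_pow_mul_one_sub, mul_one_sub, Nat.cast_succ]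
    exact sub_le_sub_left (mul_rpow_le_sum_range_pow (Real.sqrt_nonneg β) m) _

theorem geomQuot_nonneg (n : ℕ) {β : ℝ} (hβ₀ : 0 ≤ β) (hβ₁ : β ≤ 1) : 0 ≤ geomQuot n β := by
  rw [geomQuot]
  split_ifs
  · positivity
  · exact div_nonneg (sub_nonneg.2 (Real.rpow_le_one hβ₀ hβ₁ (by positivity)))
      (sub_nonneg.2 (Real.sqrt_le_one.2 hβ₁))

theorem geomQuot_le_minFactor {n : ℕ} (hn : 2 ≤ n) {β : ℝ} (hβ₀ : 0 ≤ β) (hβ₁ : β ≤ 1) :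
    geomQuot n β ≤ minFactor n β := by
  rcases eq_or_lt_of_le hβ₁ with rfl | hβ
  · simp only [geomQuot, minFactor, if_true, le_refl]
  · have one_sub_pos : 0 < 1 - √β := by rwa [sub_pos, Real.sqrt_lt' one_pos, one_pow]
    have bernoulli : 1 + (n : ℝ) / 2 * (√β - 1) ≤ √β ^ ((n : ℝ) / 2) := by
      have one_le_half : (1 : ℝ) ≤ n / 2 := by
        rw [le_div_iff₀ two_pos, one_mul]
        exact_mod_cast hn
      simpa only [add_sub_cancel] using one_add_mul_self_le_rpow_one_add
        (neg_le_sub_iff_le_add.2 (le_add_of_nonneg_left (Real.sqrt_nonneg β))) one_le_half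
    rw [geomQuot_of_ne_one n hβ₀ hβ.ne, minFactor, if_neg hβ.ne]
    refine le_min ?_ ?_
    · rw [div_le_iff₀ one_sub_pos]
      linarith
    · gcongr
      exact sub_le_self _ (by positivity)

theorem mul_minFactor_le {n : ℕ} {α β : ℝ} (hα : 0 ≤ α) (hβ : 0 ≤ β) (hαβ : α + β ≤ 1) :
    α * minFactor n β ≤ 1 + √β := by
  rw [minFactor]
  split_ifs with h
  · rw [show α = 0 by linarith, zero_mul]
    positivity
  · have one_sub_pos : 0 < 1 - √β := by
      rw [sub_pos, Real.sqrt_lt' one_pos, one_pow]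
      exact lt_of_le_of_ne (by linarith) h
    calc α * min ((n : ℝ) / 2) (1 / (1 - √β))
        ≤ (1 - β) * (1 / (1 - √β)) :=
          mul_le_mul (by linarith) (min_le_right _ _) (by positivity) (by linarith)
      _ = 1 + √β := by
          rw [mul_one_div, div_eq_iff one_sub_pos.ne']
          linear_combination Real.sq_sqrt hβ

end GeometricFactor

section Matrix

variable {N n : ℕ} (Z : Matrix (Fin N) (Fin n) ℂ)

theorem factorial_div_mul_per (hnN : n ≤ N) :
    (((N - n).factorial : ℂ) / (N.factorial : ℂ)) * per Z
      = 𝔼 j : Fin n ↪ Fin N, ∏ r, Z.col r (j r) := by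
  have factorial_eq : (N.factorial : ℂ) = (N - n).factorial * N.descFactorial n := by
    exact_mod_cast (Nat.factorial_mul_descFactorial hnN).symm
  have : ((N - n).factorial : ℂ) ≠ 0 := by exact_mod_cast Nat.factorial_ne_zero _
  rw [Fintype.expect_eq_sum_div_card, Fintype.card_embedding_eq, Fintype.card_fin,
    Fintype.card_fin, factorial_eq, div_mul_eq_mul_div, mul_div_mul_left _ _ this]
  rfl

theorem colMean_eq_expect (r : Fin n) : colMean Z r = 𝔼 j, Z.col r j := by
  rw [Fintype.expect_eq_sum_div_card, Fintype.card_fin, colMean, one_div_mul_eq_div]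
  rfl

theorem beta_eq_expect : beta Z = 𝔼 r, ‖𝔼 j, Z.col r j‖ ^ 2 := by
  simp only [beta, colMean_eq_expect, one_div_mul_eq_div, Fintype.expect_eq_sum_div_card (K := ℝ),
    Fintype.card_fin]

theorem alpha_eq_expect_meanSqDev : alpha Z = 𝔼 r, meanSqDev (Z.col r) := by
  simp only [alpha, meanSqDev, colMean_eq_expect, Fintype.expect_eq_sum_div_card (K := ℝ),
    Fintype.card_fin, ← sum_div, div_div, one_div_mul_eq_div, mul_comm (N : ℝ)]
  rfl

theorem theta_eq_rmsDiffMul : theta Z = rmsDiffMul Z.col := by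
  have expect_offDiag (m : ℕ) (g : Fin m × Fin m → ℝ) :
      𝔼 p ∈ univ.offDiag, g p = (∑ p with p.1 ≠ p.2, g p) / (m * (m - 1)) := by
    rw [expect_eq_sum_div_card, cast_card_offDiag_univ, Fintype.card_fin]
    congr
    ext
    simp
  have mul_sub_one_nonneg (m : ℕ) : (0 : ℝ) ≤ m * (m - 1) := by
    simpa only [cast_card_offDiag_univ, Fintype.card_fin]
      using Nat.cast_nonneg (α := ℝ) #(univ : Finset (Fin m)).offDiag
  simp only [theta, rmsDiffMul, meanDiffMul, expect_offDiag, div_pow, ← sum_div, div_div]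
  rw [Real.sqrt_div' _ (mul_nonneg (sq_nonneg _) (mul_sub_one_nonneg n)),
    Real.sqrt_mul (sq_nonneg _), Real.sqrt_sq (mul_sub_one_nonneg N), one_div_mul_eq_div]
  rfl

theorem alpha_nonneg : 0 ≤ alpha Z := by
  rw [alpha_eq_expect_meanSqDev]
  exact expect_nonneg fun r _ => meanSqDev_nonneg _

theorem beta_nonneg : 0 ≤ beta Z := by
  rw [beta_eq_expect]
  exact expect_nonneg fun r _ => sq_nonneg _

variable {Z}

theorem alpha_add_beta_le_one (hN : N ≠ 0) (hn : n ≠ 0) (hZ : ∀ j r, ‖Z j r‖ ≤ 1) :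
    alpha Z + beta Z ≤ 1 := by
  have : NeZero N := ⟨hN⟩
  have : NeZero n := ⟨hn⟩
  rw [alpha_eq_expect_meanSqDev, beta_eq_expect, ← expect_add_distrib]
  simp only [meanSqDev_add_norm_expect_sq]
  exact expect_le univ_nonempty fun r _ => expect_le univ_nonempty fun j _ =>
    pow_le_one₀ (norm_nonneg _) (hZ j r)

theorem norm_per_sub_prod_le (hn : n ≠ 0) (hnN : n ≤ N) (hZ : ∀ j r, ‖Z j r‖ ≤ 1) :
    ‖(((N - n).factorial : ℂ) / (N.factorial : ℂ)) * per Z - ∏ r, colMean Z r‖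
      ≤ ((n - 1) / (2 * N)) * theta Z * geomQuot n (beta Z) := by
  have hβ₁ : beta Z ≤ 1 := by
    linarith [alpha_nonneg Z, alpha_add_beta_le_one (by omega) hn hZ]
  obtain ⟨m, rfl⟩ := Nat.exists_eq_succ_of_ne_zero hn
  calc ‖(((N - (m + 1)).factorial : ℂ) / (N.factorial : ℂ)) * per Z - ∏ r, colMean Z r‖
      ≤ rmsDiffMul Z.col / (2 * N) * ∑ t ∈ range (m + 1), t * √(beta Z) ^ (m - t) := by
        have := norm_expect_embedding_prod_sub_le_rmsDiffMul (Fin.castLEEmb hnN)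
          (x := Z.col) fun r j => hZ j r
        simpa only [factorial_div_mul_per Z hnN, colMean_eq_expect, ← beta_eq_expect,
          Fintype.card_fin, Fin.card_Iio, Fin.card_Ioi, Nat.succ_eq_add_one, Nat.add_sub_cancel,
          ← Fin.sum_univ_eq_sum_range fun t => (t : ℝ) * √(beta Z) ^ (m - t)] using this
    _ ≤ rmsDiffMul Z.col / (2 * N) * (m * geomQuot (m + 1) (beta Z)) :=
        mul_le_mul_of_nonneg_left (sum_mul_sqrt_pow_le_geomQuot (beta_nonneg Z) hβ₁ m)
          (div_nonneg (Real.sqrt_nonneg _) (by positivity))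
    _ = _ := by
        rw [theta_eq_rmsDiffMul, Nat.cast_succ]
        ring

theorem theta_le (hN : 2 ≤ N) : theta Z ≤ 2 * N / (N - 1) * alpha Z := by
  have : Nontrivial (Fin N) := Fin.nontrivial_iff_two_le.2 hN
  simpa only [theta_eq_rmsDiffMul, alpha_eq_expect_meanSqDev, Fintype.card_fin]
    using rmsDiffMul_le Z.col

theorem div_mul_theta_le (hN : 2 ≤ N) (hn : n ≠ 0) :
    ((n - 1) / (2 * N)) * theta Z ≤ ((n - 1) / (N - 1)) * alpha Z := by
  have one_le_n : (1 : ℝ) ≤ n := by exact_mod_cast Nat.one_le_iff_ne_zero.2 hn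
  calc ((n - 1 : ℝ) / (2 * N)) * theta Z
      ≤ ((n - 1) / (2 * N)) * (2 * N / (N - 1) * alpha Z) :=
        mul_le_mul_of_nonneg_left (theta_le hN)
          (div_nonneg (sub_nonneg.2 one_le_n) (by positivity))
    _ = ((n - 1) / (N - 1)) * alpha Z := by
        rw [← mul_assoc, div_mul_div_cancel₀ (by positivity)]

end Matrix

end RectPerm

theorem mainTheorem7 (N n : ℕ) (hn : 2 ≤ n) (hnN : n ≤ N)
    (Z : Matrix (Fin N) (Fin n) ℂ) (hZ : ∀ (j : Fin N) (r : Fin n), ‖Z j r‖ ≤ 1) :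
    ‖(((N - n).factorial : ℂ) / (N.factorial : ℂ)) * RectPerm.per Z
        - ∏ r : Fin n, RectPerm.colMean Z r‖
      ≤ (((n : ℝ) - 1) / (2 * (N : ℝ))) * RectPerm.theta Z
          * RectPerm.geomQuot n (RectPerm.beta Z) ∧
    (((n : ℝ) - 1) / (2 * (N : ℝ))) * RectPerm.theta Z
          * RectPerm.geomQuot n (RectPerm.beta Z)
      ≤ (((n : ℝ) - 1) / ((N : ℝ) - 1)) * RectPerm.alpha Z
          * RectPerm.minFactor n (RectPerm.beta Z) ∧
    (((n : ℝ) - 1) / ((N : ℝ) - 1)) * RectPerm.alpha Z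
          * RectPerm.minFactor n (RectPerm.beta Z)
      ≤ (1 + √(RectPerm.beta Z)) * (((n : ℝ) - 1) / ((N : ℝ) - 1)) := by
  have hn₀ : n ≠ 0 := by omega
  have hα := RectPerm.alpha_nonneg Z
  have hβ₀ := RectPerm.beta_nonneg Z
  have hαβ := RectPerm.alpha_add_beta_le_one (by omega) hn₀ hZ
  have hβ₁ : RectPerm.beta Z ≤ 1 := by linarith
  have hc : 0 ≤ ((n : ℝ) - 1) / ((N : ℝ) - 1) :=
    div_nonneg (sub_nonneg.2 (by exact_mod_cast (by omega : 1 ≤ n)))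
      (sub_nonneg.2 (by exact_mod_cast (by omega : 1 ≤ N)))
  refine ⟨RectPerm.norm_per_sub_prod_le hn₀ hnN hZ, ?_, ?_⟩
  · exact mul_le_mul (RectPerm.div_mul_theta_le (hn.trans hnN) hn₀)
      (RectPerm.geomQuot_le_minFactor hn hβ₀ hβ₁) (RectPerm.geomQuot_nonneg n hβ₀ hβ₁)
      (mul_nonneg hc hα)
  · rw [mul_assoc, mul_comm]
    exact mul_le_mul_of_nonneg_right (RectPerm.mul_minFactor_le hα hβ₀ hαβ) hc
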